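/- **Setting.** All maps are $C^\infty$. For $U\subseteq\mathbb{R}^3$ open, $FU=U\times Gl(3,\mathbb{R})$ denotes the linear frame bundle, $\pi:FU\to U$ its projection, and $e_1=(0,\mathrm{id})\in F\mathbb{R}^3$. A *frame isomorphism* $\Psi:FU\to FV$ is a principal bundle isomorphism ($U,V\subseteq\mathbb R^3$ open) inducing the identity on $Gl(3,\mathbb{R})$; $\psi$ denotes its base map. For $v\in\mathbb{R}^3$, $\tau_v$ is the translation by $v$ and $F\tau_v(x,z)=(x+v,z)$. For open $U,V\subseteq\mathbb{R}^3$, $\tilde J^1(FU,FV)$ is the set of classes $j^1_{x,y}\Psi$, $x\in U$, $y=\psi(x)\in V$, of the 1-jets $j^1_{X,\Psi(X)}\Psi$ ($\pi(X)=x$) of local frame isomorphisms, under the action $j^1_{X,Y}\Psi\mapsto j^1_{X g,Yg}\Psi$ of $Gl(3,\mathbb{R})$, and $\tilde J^1(FU)=\tilde J^1(FU,FU)$, a Lie groupoid over $U$ under composition of jets. $\overline F^2U$ is the bundle of the jets $j^1_{e_1,\Psi(e_1)}\Psi$ with $\psi(0)\in U$ (non-holonomic frames of second order; such a jet is a frame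 at $\psi(0)$), and $\overline G^2(3)$ is the group of those with $\psi(0)=0$, which acts on $\overline F^2U$ from the right by composition of jets. *Structures and prolongations.* For a Lie subgroup $\overline G$ of $\overline G^2(3)$, a second-order non-holonomic $\overline G$-structure on $U$ is a reduced subbundle $\overline\omega$ of $\overline F^2U$ with structure group $\overline G$. Let $P,Q$ be smooth sections of $FU$. The prolongation $P^1(Q)$ is the section of $\overline F^2U$ that projects onto $P$ and whose horizontal vectors at $P(x)$ are $T_xP(Q_a(x))$, $a=1,2,3$; in coordinates $P^1(Q)(x)=\big((x^i,P^i_j),Q^i_j,\sum_l Q^l_k\,\partial P^i_j/\partial x^l\big)$. It is called integrable if $Q$ is integrable, i.e. near each point $Q$ is the coordinate frame of some chart. A $\overline G$-structure $\overline\omega$ on $U$ is a *second-order non-holonomic integrable prolongation* if $U$ is covered by open sets on each of which there is an integrable prolongation $P^1(Q)$ with values in $\overline\omega$. *Cosserat media.* Let $\mathcal B$ be a body, identified through a reference configuration with an open subset of $\mathbb{R}^3$, and let $W:\tilde J^1(F\mathcal B)\to V$ be a smooth map into a normed real vector space that does not depend on the end point: $W(j^1_{x,y}\Psi)=W(j^1_{x,z}(F\tau_{z-y}\circ\Psi))$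 for all $x,y,z\in\mathcal B$. Hence $W$ extends to $\tilde J^1(F\mathcal B,F\mathbb{R}^3)$. Let $\overline\Omega(\mathcal B)$ be the set of all $g=j^1_{x,y}\Psi\in\tilde J^1(F\mathcal B)$ such that $W(k\cdot g)=W(k)$ for every $k\in\tilde J^1(F\mathcal B,F\mathbb{R}^3)$ with source $y$; as usual, assume that $\overline\Omega(\mathcal B)$ is a Lie subgroupoid of $\tilde J^1(F\mathcal B)$. A *reference crystal* is a frame $\overline Z_0\in\overline F^2\mathcal B$, at a point $z_0\in\mathcal B$. Put $$\overline\omega_{\overline G_0}(\mathcal B)=\{g\cdot\overline Z_0 : g\in\overline\Omega(\mathcal B)\text{ with source }z_0\},\qquad \overline G_0=\overline Z_0^{-1}\cdot\overline G(z_0)\cdot\overline Z_0,$$ where $\overline G(z_0)$ is the isotropy group of $\overline\Omega(\mathcal B)$ at $z_0$. An open set $U\subseteq\mathcal B$ *admits a homogeneous deformation* if there is a frame isomorphism $\overline\kappa$ of $FU$ onto $FU'$, with $U'\subseteq\mathbb{R}^3$ open and with base map $\kappa$, such that $$j^1_{0,x}\big(\overline\kappa^{-1}\circ F\tau_{\kappa(x)}\big)\in\overline\omega_{\overline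 G_0}(\mathcal B)\qquad\text{for all }x\in U .$$ $\mathcal B$ is *homogeneous with respect to $\overline Z_0$* if $U=\mathcal B$ admits a homogeneous deformation, and *locally homogeneous with respect to $\overline Z_0$* if $\mathcal B$ is covered by open subsets that admit homogeneous deformations. **Proposition.** If $\mathcal B$ is homogeneous with respect to $\overline Z_0$, then $\overline\omega_{\overline G_0}(\mathcal B)$ is a second-order non-holonomic $\overline G_0$-structure on $\mathcal B$ and a second-order non-holonomic integrable prolongation. Conversely, if $\overline\omega_{\overline G_0}(\mathcal B)$ is a $\overline G_0$-structure and a second-order non-holonomic integrable prolongation, then $\mathcal B$ is locally homogeneous with respect to $\overline Z_0$. -/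

import Mathlib

open Set
open scoped ContDiff

noncomputable section

namespace Cosserat

/-! ### Frame bundles of open subsets of ℝ³ -/

/-! The definitions are written for a normed space `E` and used for `E = ℝ³`. -/

variable {E : Type*} [NormedAddCommGroup E] [NormedSpace ℝ E]

/-- Linear endomorphisms of `E`; the group `Gl(E)` is its group of units. -/
abbrev End (E : Type*) [NormedAddCommGroup E] [NormedSpace ℝ E] : Type _ := E →L[ℝ] E

/-- The vector space that contains the frame bundle `FE` as an open subset: the pair `(x, z)` with
`z` invertible is the linear frame `z : E → T_x E = E` at `x`. -/
abbrev FrameSpace (E : Type*) [NormedAddCommGroup E] [NormedSpace ℝ E] : Type _ := E × End E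

/-- The frame bundle `FU` of a subset `U` of `E`. -/
def frames (U : Set E) : Set (FrameSpace E) := {p | p.1 ∈ U ∧ IsUnit p.2}

/-- `Ψ : FU → FV` is an isomorphism of principal bundles whose group morphism is the identity of
`Gl(E)`, with `U` and `V` open. -/
structure IsFrameIso (Ψ : OpenPartialHomeomorph (FrameSpace E) (FrameSpace E)) (U V : Set E) :
    Prop where
  isOpen_left : IsOpen U
  isOpen_right : IsOpen V
  source_eq : Ψ.source = frames U
  target_eq : Ψ.target = frames V
  contDiffOn : ContDiffOn ℝ ∞ Ψ (frames U)
  contDiffOn_symm : ContDiffOn ℝ ∞ Ψ.symm (frames V)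
  equivariant : ∀ p ∈ frames U, ∀ g : (End E)ˣ,
    Ψ (p.1, p.2 * (g : End E)) = ((Ψ p).1, (Ψ p).2 * (g : End E))

/-- The map `Fτ_v` of `FE` induced by the translation `τ_v` of `E`. -/
def frameTransl (v : E) : FrameSpace E → FrameSpace E := fun p => (p.1 + v, p.2)

/-! ### Jets of frame bundle isomorphisms -/

/-- The space of the classes `j¹_{x,y} Ψ`, under the right action of `Gl(E)`, of the 1-jets of
local isomorphisms `Ψ` of frame bundles. The class is recorded by its unique representative with
source the frame `(x, 1)`, through the coordinates `(xⁱ, yʲ, yʲᵢ, yʲ,ᵢ, yʲᵢ,ₖ)`.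
The 1-jet of `Ψ` at `e₁ = (0, 1)` is the case `x = 0`. -/
abbrev Jet (E : Type*) [NormedAddCommGroup E] [NormedSpace ℝ E] : Type _ :=
  E × E × End E × End E × (E →L[ℝ] End E)

namespace Jet

/-- The source `x` of `j¹_{x,y} Ψ`. -/
def src (j : Jet E) : E := j.1

/-- The target `y` of `j¹_{x,y} Ψ`. -/
def tgt (j : Jet E) : E := j.2.1

/-- The frame part `yʲᵢ` of `Ψ (x, 1)`. -/
def frame (j : Jet E) : End E := j.2.2.1

/-- The derivative `yʲ,ᵢ` at `x` of the base map of `Ψ`. -/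
def lin (j : Jet E) : End E := j.2.2.2.1

/-- The derivative `yʲᵢ,ₖ` at `x` of the frame part of `Ψ (·, 1)`. -/
def der (j : Jet E) : E →L[ℝ] End E := j.2.2.2.2

/-- The identity jet at `x`. -/
def idAt (x : E) : Jet E := (x, x, 1, 1, 0)

/-- The composition `k · j` of jets (meaningful when `k.src = j.tgt`); the last component is
`v ↦ k.der (j.lin v) * j.frame + k.frame * j.der v`. -/
def comp (k j : Jet E) : Jet E :=
  (j.src, k.tgt, k.frame * j.frame, k.lin * j.lin,
    ((ContinuousLinearMap.mul ℝ (End E)).flip j.frame) ∘L (k.der ∘L j.lin) +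
      (ContinuousLinearMap.mul ℝ (End E) k.frame) ∘L j.der)

end Jet

/-- The class `j¹_{x,ψ(x)} Ψ`. -/
def frameJet (Ψ : FrameSpace E → FrameSpace E) (x : E) : Jet E :=
  (x, (Ψ (x, 1)).1, (Ψ (x, 1)).2,
    (ContinuousLinearMap.fst ℝ E (End E)) ∘L (fderiv ℝ Ψ (x, 1)) ∘L
      (ContinuousLinearMap.inl ℝ E (End E)),
    (ContinuousLinearMap.snd ℝ E (End E)) ∘L (fderiv ℝ Ψ (x, 1)) ∘L
      (ContinuousLinearMap.inl ℝ E (End E)))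

/-- `J̃¹(FU, FV)`: the jets `j¹_{x,y} Ψ`, with `x ∈ U` and `y ∈ V`, of local isomorphisms `Ψ` of
frame bundles. -/
def jets (U V : Set E) : Set (Jet E) :=
  {j | ∃ (Ψ : OpenPartialHomeomorph (FrameSpace E) (FrameSpace E)) (U' V' : Set E) (x : E),
    IsFrameIso Ψ U' V' ∧ x ∈ U' ∧ x ∈ U ∧ (Ψ (x, 1)).1 ∈ V ∧ j = frameJet Ψ x}

/-- The second-order non-holonomic frame bundle `F̄²B`: the jets at `e₁`; a jet `Z` is a frame
at the point `Z.tgt`. -/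
def nonholonomicFrames (B : Set E) : Set (Jet E) := jets {0} B

/-- The group `Ḡ²(n)` of the non-holonomic frames of second order of `E` at `0`; the product, and
the right action on `F̄²B`, is the composition of jets. -/
def nonholonomicGroup (E : Type*) [NormedAddCommGroup E] [NormedSpace ℝ E] :
    Set (Jet E) :=
  jets {0} {0}

/-! Facts that justify the description of the classes of jets and of their composition. -/

theorem isOpen_frames [CompleteSpace E] {U : Set E} (hU : IsOpen U) : IsOpen (frames U) :=
  (hU.preimage continuous_fst).inter (Units.isOpen.preimage continuous_snd)

theorem IsFrameIso.hasFDerivAt [CompleteSpace E]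
    {Ψ : OpenPartialHomeomorph (FrameSpace E) (FrameSpace E)} {U V : Set E}
    (h : IsFrameIso Ψ U V) {p : FrameSpace E} (hp : p ∈ frames U) :
    HasFDerivAt Ψ (fderiv ℝ Ψ p) p :=
  (((h.contDiffOn p hp).contDiffAt ((isOpen_frames h.isOpen_left).mem_nhds hp)).differentiableAt
    (by simp)).hasFDerivAt

theorem IsFrameIso.fderiv_apply [CompleteSpace E]
    {Ψ : OpenPartialHomeomorph (FrameSpace E) (FrameSpace E)} {U V : Set E}
    (h : IsFrameIso Ψ U V) {x : E} (hx : x ∈ U) {A : End E} (hA : IsUnit A) (v : E) (C : End E) :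
    fderiv ℝ Ψ (x, A) (v, C) =
      ((frameJet Ψ x).lin v, (frameJet Ψ x).der v * A + (frameJet Ψ x).frame * C) := by
  have h1 : ((x, 1) : FrameSpace E) ∈ frames U := ⟨hx, isUnit_one⟩
  have hs : HasFDerivAt (fun p : FrameSpace E => Ψ (p.1, (1 : End E)))
      ((fderiv ℝ Ψ (x, 1)) ∘L (ContinuousLinearMap.inl ℝ E (End E)) ∘L
        (ContinuousLinearMap.fst ℝ E (End E))) (x, A) := by
    have hin : HasFDerivAt (fun p : FrameSpace E => ((p.1, 1) : FrameSpace E))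
        ((ContinuousLinearMap.inl ℝ E (End E)) ∘L (ContinuousLinearMap.fst ℝ E (End E)))
        (x, A) :=
      (hasFDerivAt_fst (𝕜 := ℝ) (p := ((x, A) : FrameSpace E))).prodMk
        (hasFDerivAt_const (1 : End E) ((x, A) : FrameSpace E))
    exact HasFDerivAt.comp (g := Ψ) (f := fun p : FrameSpace E => ((p.1, 1) : FrameSpace E)) (x, A)
      (h.hasFDerivAt h1) hin
  have hd := hs.fst.prodMk (hs.snd.mul' (hasFDerivAt_snd (𝕜 := ℝ) (p := ((x, A) : FrameSpace E))))
  have he : (fun p : FrameSpace E => ((Ψ (p.1, (1 : End E))).1, (Ψ (p.1, (1 : End E))).2 * p.2))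
      =ᶠ[nhds (x, A)] Ψ := by
    filter_upwards [(isOpen_frames h.isOpen_left).mem_nhds (⟨hx, hA⟩ : (x, A) ∈ frames U)] with p hp
    obtain ⟨g, hg⟩ := hp.2
    have := h.equivariant (p.1, 1) ⟨hp.1, isUnit_one⟩ g
    simp only [one_mul, hg] at this
    exact this.symm
  have hf := (hd.congr_of_eventuallyEq he.symm).fderiv
  rw [hf]
  ext1
  · simp [frameJet, Jet.lin]
  · simp [frameJet, Jet.der, Jet.frame, add_comm]

/-- Two local isomorphisms have the same 1-jet at the frame `(x, A)` exactly when their classes at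
`x` agree. -/
theorem frameJet_eq_iff [CompleteSpace E]
    {Ψ Φ : OpenPartialHomeomorph (FrameSpace E) (FrameSpace E)} {U V U' V' : Set E}
    (h : IsFrameIso Ψ U V) (h' : IsFrameIso Φ U' V') {x : E} (hx : x ∈ U) (hx' : x ∈ U')
    {A : End E} (hA : IsUnit A) :
    (Ψ (x, A) = Φ (x, A) ∧ fderiv ℝ Ψ (x, A) = fderiv ℝ Φ (x, A)) ↔
      frameJet Ψ x = frameJet Φ x := by
  have e1 : Ψ (x, A) = ((frameJet Ψ x).tgt, (frameJet Ψ x).frame * A) := by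
    obtain ⟨g, rfl⟩ := hA
    have := h.equivariant (x, 1) ⟨hx, isUnit_one⟩ g
    simpa [frameJet, Jet.tgt, Jet.frame] using this
  have e2 : Φ (x, A) = ((frameJet Φ x).tgt, (frameJet Φ x).frame * A) := by
    obtain ⟨g, rfl⟩ := hA
    have := h'.equivariant (x, 1) ⟨hx', isUnit_one⟩ g
    simpa [frameJet, Jet.tgt, Jet.frame] using this
  constructor
  · rintro ⟨hv, hd⟩
    rw [e1, e2, Prod.mk.injEq] at hv
    have hfr : (frameJet Ψ x).frame = (frameJet Φ x).frame := hA.mul_right_cancel hv.2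
    have key : ∀ v, (frameJet Ψ x).lin v = (frameJet Φ x).lin v ∧
        (frameJet Ψ x).der v = (frameJet Φ x).der v := by
      intro v
      have := DFunLike.congr_fun hd (v, (0 : End E))
      rw [h.fderiv_apply hx hA, h'.fderiv_apply hx' hA, Prod.mk.injEq, hfr] at this
      exact ⟨this.1, hA.mul_right_cancel (by simpa using this.2)⟩
    have hl : (frameJet Ψ x).lin = (frameJet Φ x).lin :=
      ContinuousLinearMap.ext fun v => (key v).1
    have hr : (frameJet Ψ x).der = (frameJet Φ x).der :=
      ContinuousLinearMap.ext fun v => (key v).2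
    exact Prod.ext rfl (Prod.ext hv.1 (Prod.ext hfr (Prod.ext hl hr)))
  · intro hj
    refine ⟨by rw [e1, e2, hj], ?_⟩
    refine ContinuousLinearMap.ext fun w => ?_
    obtain ⟨v, C⟩ := w
    rw [h.fderiv_apply hx hA, h'.fderiv_apply hx' hA, hj]

/-- `Jet.comp` is the composition of jets: `j_y κ · j_{x,y} Ψ = j_x (κ ∘ Ψ)`. -/
theorem frameJet_comp [CompleteSpace E]
    {κ Ψ : OpenPartialHomeomorph (FrameSpace E) (FrameSpace E)} {U V U' V' : Set E}
    (hκ : IsFrameIso κ U' V') (h : IsFrameIso Ψ U V) {x : E} (hx : x ∈ U)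
    (hy : (Ψ (x, 1)).1 ∈ U') :
    frameJet (κ ∘ Ψ) x = (frameJet κ (Ψ (x, 1)).1).comp (frameJet Ψ x) := by
  have h1 : ((x, 1) : FrameSpace E) ∈ frames U := ⟨hx, isUnit_one⟩
  have hu : IsUnit (Ψ (x, 1)).2 := by
    have : Ψ (x, 1) ∈ frames V := h.target_eq ▸ Ψ.map_source (h.source_eq ▸ h1)
    exact this.2
  have hp : Ψ (x, 1) ∈ frames U' := ⟨hy, hu⟩
  have hd : fderiv ℝ (κ ∘ Ψ) (x, 1) = (fderiv ℝ κ (Ψ (x, 1))) ∘L (fderiv ℝ Ψ (x, 1)) :=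
    ((hκ.hasFDerivAt hp).comp (x, 1) (h.hasFDerivAt h1)).fderiv
  have hv : κ (Ψ (x, 1)) = ((κ ((Ψ (x, 1)).1, 1)).1, (κ ((Ψ (x, 1)).1, 1)).2 * (Ψ (x, 1)).2) := by
    obtain ⟨g, hg⟩ := hu
    have := hκ.equivariant ((Ψ (x, 1)).1, 1) ⟨hy, isUnit_one⟩ g
    simpa [hg] using this
  have key : ∀ v : E, fderiv ℝ (κ ∘ Ψ) (x, 1) (v, 0) =
      ((frameJet κ (Ψ (x, 1)).1).lin ((frameJet Ψ x).lin v),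
        (frameJet κ (Ψ (x, 1)).1).der ((frameJet Ψ x).lin v) * (frameJet Ψ x).frame +
          (frameJet κ (Ψ (x, 1)).1).frame * (frameJet Ψ x).der v) := by
    intro v
    rw [hd]
    have a := h.fderiv_apply hx isUnit_one v 0
    have b := hκ.fderiv_apply hy hu ((frameJet Ψ x).lin v) ((frameJet Ψ x).der v)
    simp only [mul_one, mul_zero, add_zero] at a
    simp only [ContinuousLinearMap.comp_apply, a]
    exact b
  refine Prod.ext rfl (Prod.ext ?_ (Prod.ext ?_ (Prod.ext ?_ ?_)))
  · have := congrArg Prod.fst hv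
    exact this
  · have := congrArg Prod.snd hv
    exact this
  · refine ContinuousLinearMap.ext fun v => ?_
    have := congrArg Prod.fst (key v)
    exact this
  · refine ContinuousLinearMap.ext fun v => ?_
    have := congrArg Prod.snd (key v)
    exact this

/-! ### Lie subgroups, Lie subgroupoids, `Ḡ`-structures -/

/-- `f` is a local defining function at `p` of a subset `S` of the space of jets: on an open
neighbourhood of `p`, `S` is the zero set of the smooth map `f`, a submersion at `p`. -/
def IsDefiningFunction (S : Set (Jet E)) (p : Jet E) {k : ℕ} (f : Jet E → (Fin k → ℝ)) : Prop :=
  ∃ N : Set (Jet E), IsOpen N ∧ p ∈ N ∧ ContDiffOn ℝ ∞ f N ∧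
    Function.Surjective (fderiv ℝ f p) ∧ ∀ q ∈ N, q ∈ S ↔ f q = 0

/-- Embedded submanifolds of the space of jets (for a finite-dimensional `E`). -/
def IsEmbeddedSubmanifold (S : Set (Jet E)) : Prop :=
  ∀ p ∈ S, ∃ (k : ℕ) (f : Jet E → (Fin k → ℝ)), IsDefiningFunction S p f

/-- `Γ` is a Lie subgroupoid of `J̃¹(FB)` over `B`: a subgroupoid that is an embedded submanifold,
on which the source and the target map are submersions onto `B` (the tangent space of `Γ` at `p`
is the kernel of the derivative of a defining function). -/
structure IsLieSubgroupoid (B : Set E) (Γ : Set (Jet E)) : Prop where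
  subset : Γ ⊆ jets B B
  id_mem : ∀ x ∈ B, Jet.idAt x ∈ Γ
  comp_mem : ∀ k ∈ Γ, ∀ j ∈ Γ, k.src = j.tgt → k.comp j ∈ Γ
  inv_mem : ∀ j ∈ Γ, ∃ k ∈ Γ, k.comp j = Jet.idAt j.src ∧ j.comp k = Jet.idAt j.tgt
  submanifold : IsEmbeddedSubmanifold Γ
  src_submersion : ∀ p ∈ Γ, ∀ (k : ℕ) (f : Jet E → (Fin k → ℝ)), IsDefiningFunction Γ p f →
    ∀ v : E, ∃ w : Jet E, fderiv ℝ f p w = 0 ∧ w.src = v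
  tgt_submersion : ∀ p ∈ Γ, ∀ (k : ℕ) (f : Jet E → (Fin k → ℝ)), IsDefiningFunction Γ p f →
    ∀ v : E, ∃ w : Jet E, fderiv ℝ f p w = 0 ∧ w.tgt = v

/-- Lie subgroups of `Ḡ²(n)`. -/
structure IsLieSubgroup (G : Set (Jet E)) : Prop where
  subset : G ⊆ nonholonomicGroup E
  one_mem : Jet.idAt 0 ∈ G
  mul_mem : ∀ g ∈ G, ∀ h ∈ G, g.comp h ∈ G
  inv_mem : ∀ g ∈ G, ∃ h ∈ G, h.comp g = Jet.idAt 0 ∧ g.comp h = Jet.idAt 0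
  submanifold : IsEmbeddedSubmanifold G

/-- `S` is a second-order non-holonomic `G`-structure on `B`, that is, a reduced subbundle of
`F̄²B` with structure group the Lie subgroup `G`: locally, `S` is `σ(U) · G` for a smooth section
`σ` of `F̄²B` over `U`. -/
structure IsGStructure (B : Set E) (G S : Set (Jet E)) : Prop where
  group : IsLieSubgroup G
  subset : S ⊆ nonholonomicFrames B
  locally_trivial : ∀ x ∈ B, ∃ U : Set E, IsOpen U ∧ x ∈ U ∧ U ⊆ B ∧
    ∃ σ : E → Jet E, ContDiffOn ℝ ∞ σ U ∧ (∀ y ∈ U, σ y ∈ nonholonomicFrames B ∧ (σ y).tgt = y) ∧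
      ∀ Z ∈ nonholonomicFrames B, Z.tgt ∈ U → (Z ∈ S ↔ ∃ g ∈ G, Z = (σ Z.tgt).comp g)

/-! ### Non-holonomic integrable prolongations of second order -/

/-- `P` is the frame part of a smooth section `x ↦ (x, P x)` of `FU`. -/
def IsParallelism (U : Set E) (P : E → End E) : Prop :=
  ContDiffOn ℝ ∞ P U ∧ ∀ x ∈ U, IsUnit (P x)

/-- The parallelism `Q` on `U` is integrable: around each point of `U` there is a chart `ψ` whose
coordinate frame `∂/∂x¹, …, ∂/∂xⁿ` is `Q`. -/
def IsIntegrableParallelism (U : Set E) (Q : E → End E) : Prop :=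
  ∀ z ∈ U, ∃ ψ : OpenPartialHomeomorph E E, z ∈ ψ.source ∧ ψ.source ⊆ U ∧
    ContDiffOn ℝ ∞ ψ ψ.source ∧ ContDiffOn ℝ ∞ ψ.symm ψ.target ∧
      ∀ x ∈ ψ.source, Q x = fderiv ℝ ψ.symm (ψ x)

/-- The second-order non-holonomic prolongation `P¹(Q)`: the frame at `x` that lies over the frame
`P x` and whose horizontal part consists of the vectors `T_x P (Q_a x)`. Its components are
`(0, xⁱ, Pⁱⱼ, Qⁱⱼ, ∑ₗ Qˡₖ ∂Pⁱⱼ/∂xˡ)`. -/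
def prolongation (P Q : E → End E) (x : E) : Jet E :=
  (0, x, P x, Q x, (fderiv ℝ P x) ∘L (Q x))

/-- The `G`-structure `S` on `B` is a second-order non-holonomic integrable prolongation: `B` is
covered by open sets `U` with integrable prolongations `P¹(Q)` (that is, with `Q` integrable) on
`U` that take values in `S`. -/
def IsIntegrableProlongation (B : Set E) (G S : Set (Jet E)) : Prop :=
  IsGStructure B G S ∧
    ∀ x ∈ B, ∃ U : Set E, IsOpen U ∧ x ∈ U ∧ U ⊆ B ∧
      ∃ P Q : E → End E, IsParallelism U P ∧ IsParallelism U Q ∧ IsIntegrableParallelism U Q ∧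
        ∀ y ∈ U, prolongation P Q y ∈ S

/-! ### Cosserat media -/

/-- `W : J̃¹(FB) → V` is a mechanical response: it is smooth and does not depend on the end point,
`W (j_{x,y} Ψ) = W (j_{x,z} (Fτ_{z-y} ∘ Ψ))`. The values of `W` outside `J̃¹(FB)` are
irrelevant. -/
structure IsMechanicalResponse {V : Type*} [NormedAddCommGroup V] [NormedSpace ℝ V]
    (B : Set E) (W : Jet E → V) : Prop where
  contDiffOn : ContDiffOn ℝ ∞ W (jets B B)
  indep : ∀ (Ψ : OpenPartialHomeomorph (FrameSpace E) (FrameSpace E)) (U' V' : Set E),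
    IsFrameIso Ψ U' V' → ∀ x ∈ U', x ∈ B → (Ψ (x, 1)).1 ∈ B → ∀ z ∈ B,
      W (frameJet Ψ x) = W (frameJet (frameTransl (z - (Ψ (x, 1)).1) ∘ Ψ) x)

/-- The extension to `J̃¹(FB, FE)` of a response `W` that does not depend on the end point:
the end point of a jet is first translated to its source, a point of `B`. -/
def extendedResponse {V : Type*} (W : Jet E → V) (j : Jet E) : V :=
  W ((frameJet (frameTransl (j.src - j.tgt)) j.tgt).comp j)

/-- The material groupoid `Ω̄(B)`: the jets `g = j_{x,y} Ψ` of `J̃¹(FB)` such that `W (k · g) = W k`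
for every infinitesimal deformation `k` at `y`. -/
def materialGroupoid {V : Type*} (B : Set E) (W : Jet E → V) : Set (Jet E) :=
  {g | g ∈ jets B B ∧
    ∀ k ∈ jets {g.tgt} univ, extendedResponse W (k.comp g) = extendedResponse W k}

/-- The uniform references `ω̄_{Ḡ₀}(B) = Ω̄_{z₀}(B) · Z₀`, for a reference crystal `Z₀` at `z₀`. -/
def uniformReferences {V : Type*} (B : Set E) (W : Jet E → V) (Z₀ : Jet E) : Set (Jet E) :=
  {Z | ∃ g ∈ materialGroupoid B W, g.src = Z₀.tgt ∧ Z = g.comp Z₀}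

/-- The group `Ḡ₀ = Z₀⁻¹ · Ḡ(z₀) · Z₀`, with `Ḡ(z₀)` the group of the material symmetries at `z₀`;
the equality `h = Z₀⁻¹ · g · Z₀` is written `Z₀ · h = g · Z₀`. -/
def crystalGroup {V : Type*} (B : Set E) (W : Jet E → V) (Z₀ : Jet E) : Set (Jet E) :=
  {h | h ∈ nonholonomicGroup E ∧ ∃ g ∈ materialGroupoid B W,
    g.src = Z₀.tgt ∧ g.tgt = Z₀.tgt ∧ Z₀.comp h = g.comp Z₀}

/-- There is a deformation `κ̄` of `FU` (an isomorphism of `FU` onto `FV` with `V = κ(U)` open in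
`E`) such that `x ↦ j_{0,x} (κ̄⁻¹ ∘ Fτ_{κ(x)})` is a uniform reference over `U`. -/
def HasHomogeneousDeformation {V : Type*} (B : Set E) (W : Jet E → V) (Z₀ : Jet E) (U : Set E) :
    Prop :=
  ∃ (κ : OpenPartialHomeomorph (FrameSpace E) (FrameSpace E)) (U' : Set E), IsFrameIso κ U U' ∧
    ∀ x ∈ U, frameJet (κ.symm ∘ frameTransl (κ (x, 1)).1) 0 ∈ uniformReferences B W Z₀

/-- `B` is homogeneous with respect to the reference crystal `Z₀`. -/
def IsHomogeneous {V : Type*} (B : Set E) (W : Jet E → V) (Z₀ : Jet E) : Prop :=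
  HasHomogeneousDeformation B W Z₀ B

/-- `B` is locally homogeneous with respect to the reference crystal `Z₀`. -/
def IsLocallyHomogeneous {V : Type*} (B : Set E) (W : Jet E → V) (Z₀ : Jet E) : Prop :=
  ∀ x ∈ B, ∃ U : Set E, IsOpen U ∧ x ∈ U ∧ U ⊆ B ∧ HasHomogeneousDeformation B W Z₀ U

end Cosserat

end

open Cosserat

noncomputable section

namespace Cosserat

open Filter Topology

variable {E : Type*} [NormedAddCommGroup E] [NormedSpace ℝ E]

/-! ### The groupoid of jets -/

namespace Jet

/-! In the coordinates of `Jet`, the jets of local frame isomorphisms are exactly the tuples with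
invertible frame and linear parts (`mem_jets_iff`), so that jets form a groupoid with explicit
smooth composition and inversion.

If κ̄ is a homogeneous deformation with base map ψ, let P(x) be the frame part of κ̄⁻¹ at ψ(x) and
Q(x) the derivative of ψ⁻¹ at ψ(x). Then Q is the coordinate frame of the chart ψ, and by the chain
rule the jet of κ̄⁻¹ ∘ Fτ at 0 is P¹(Q)(x). Homogeneity thus says that an integrable prolongation
takes values in the uniform references. The converse reads the same computation backwards: a local
pair (P, Q) with Q = ∂ψ⁻¹ determines κ̄⁻¹ as (y, z) ↦ (ψ⁻¹ y, P(ψ⁻¹ y) z).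

It remains to show, in the homogeneous case, that the uniform references form a Ḡ₀-structure. Any
two of them differ on the left by a material isomorphism, so each fibre is a coset of Ḡ₀
(`mem_uniformReferences_iff_exists`), and the smooth section P¹(Q) trivializes. That Ḡ₀ is an
embedded submanifold (`isEmbeddedSubmanifold_crystalGroup`) also comes from this section:
conjugation by it straightens the material groupoid locally into Ḡ₀ times the pairs of end points,
and a defining function of the groupoid yields one of Ḡ₀ once the end points are fixed. -/

@[simp] theorem src_comp (k j : Jet E) : (k.comp j).src = j.src := rfl
@[simp] theorem tgt_comp (k j : Jet E) : (k.comp j).tgt = k.tgt := rfl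
@[simp] theorem frame_comp (k j : Jet E) : (k.comp j).frame = k.frame * j.frame := rfl
@[simp] theorem lin_comp (k j : Jet E) : (k.comp j).lin = k.lin * j.lin := rfl
@[simp] theorem der_comp_apply (k j : Jet E) (v : E) :
    (k.comp j).der v = k.der (j.lin v) * j.frame + k.frame * j.der v := rfl
@[simp] theorem src_idAt (x : E) : (idAt x).src = x := rfl
@[simp] theorem tgt_idAt (x : E) : (idAt x).tgt = x := rfl
@[simp] theorem frame_idAt (x : E) : (idAt x).frame = 1 := rfl
@[simp] theorem lin_idAt (x : E) : (idAt x).lin = 1 := rfl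
@[simp] theorem der_idAt (x : E) : (idAt x).der = 0 := rfl

theorem ext {j k : Jet E} (h1 : j.src = k.src) (h2 : j.tgt = k.tgt) (h3 : j.frame = k.frame)
    (h4 : j.lin = k.lin) (h5 : ∀ v, j.der v = k.der v) : j = k :=
  Prod.ext h1 (Prod.ext h2 (Prod.ext h3 (Prod.ext h4 (ContinuousLinearMap.ext h5))))

theorem comp_assoc (l k j : Jet E) : (l.comp k).comp j = l.comp (k.comp j) :=
  ext rfl rfl (mul_assoc _ _ _) (mul_assoc _ _ _) fun v => by
    simp [mul_add, add_mul, mul_assoc, add_assoc]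

theorem idAt_comp {j : Jet E} {y : E} (h : j.tgt = y) : (idAt y).comp j = j :=
  ext rfl h.symm (one_mul _) (one_mul _) fun v => by simp

theorem comp_idAt {j : Jet E} {x : E} (h : j.src = x) : j.comp (idAt x) = j :=
  ext h.symm rfl (mul_one _) (mul_one _) fun v => by simp

/-- The inverse of a jet (meaningful when its frame part and its linear part are invertible). -/
def inv (j : Jet E) : Jet E :=
  (j.tgt, j.src, Ring.inverse j.frame, Ring.inverse j.lin,
    -- The derivative of y ↦ A(ψ⁻¹ y)⁻¹, for a base map ψ and a frame part A: the rule for inverses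
    -- gives -A⁻¹ (dA ∘ dψ⁻¹) A⁻¹.
    -(((ContinuousLinearMap.mul ℝ (End E)).flip (Ring.inverse j.frame)) ∘L
      (ContinuousLinearMap.mul ℝ (End E) (Ring.inverse j.frame)) ∘L
        (j.der ∘L Ring.inverse j.lin)))

@[simp] theorem src_inv (j : Jet E) : j.inv.src = j.tgt := rfl
@[simp] theorem tgt_inv (j : Jet E) : j.inv.tgt = j.src := rfl
@[simp] theorem frame_inv (j : Jet E) : j.inv.frame = Ring.inverse j.frame := rfl
@[simp] theorem lin_inv (j : Jet E) : j.inv.lin = Ring.inverse j.lin := rfl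
@[simp] theorem der_inv_apply (j : Jet E) (v : E) : j.inv.der v =
    -(Ring.inverse j.frame * j.der (Ring.inverse j.lin v) * Ring.inverse j.frame) := rfl

theorem inv_comp {j : Jet E} (hA : IsUnit j.frame) (hL : IsUnit j.lin) :
    j.inv.comp j = idAt j.src :=
  ext rfl rfl (Ring.inverse_mul_cancel _ hA) (Ring.inverse_mul_cancel _ hL) fun v => by
    have h : Ring.inverse j.lin (j.lin v) = v :=
      DFunLike.congr_fun (Ring.inverse_mul_cancel _ hL) v
    simp [h, mul_assoc, Ring.inverse_mul_cancel _ hA]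

theorem comp_inv {j : Jet E} (hA : IsUnit j.frame) (hL : IsUnit j.lin) :
    j.comp j.inv = idAt j.tgt :=
  ext rfl rfl (Ring.mul_inverse_cancel _ hA) (Ring.mul_inverse_cancel _ hL) fun v => by
    simp [← mul_assoc, Ring.mul_inverse_cancel _ hA]

/-! ### Smoothness of composition and inversion of jets -/

section Smooth

variable {F : Type*} [NormedAddCommGroup F] [NormedSpace ℝ F] {n : WithTop ℕ∞}

theorem contDiff_frame : ContDiff ℝ n (frame : Jet E → End E) :=
  contDiff_fst.comp (contDiff_snd.comp contDiff_snd)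

theorem contDiff_lin : ContDiff ℝ n (lin : Jet E → End E) :=
  contDiff_fst.comp (contDiff_snd.comp (contDiff_snd.comp contDiff_snd))

theorem contDiff_der : ContDiff ℝ n (der : Jet E → E →L[ℝ] End E) :=
  contDiff_snd.comp (contDiff_snd.comp (contDiff_snd.comp contDiff_snd))

theorem contDiff_src : ContDiff ℝ n (src : Jet E → E) := contDiff_fst

theorem contDiff_tgt : ContDiff ℝ n (tgt : Jet E → E) := contDiff_fst.comp contDiff_snd

theorem contDiff_comp : ContDiff ℝ n (fun p : Jet E × Jet E => p.1.comp p.2) := by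
  have f1 := (contDiff_frame (E := E) (n := n)).comp (contDiff_fst (E := Jet E) (F := Jet E))
  have f2 := (contDiff_frame (E := E) (n := n)).comp (contDiff_snd (E := Jet E) (F := Jet E))
  have l1 := (contDiff_lin (E := E) (n := n)).comp (contDiff_fst (E := Jet E) (F := Jet E))
  have l2 := (contDiff_lin (E := E) (n := n)).comp (contDiff_snd (E := Jet E) (F := Jet E))
  have d1 := (contDiff_der (E := E) (n := n)).comp (contDiff_fst (E := Jet E) (F := Jet E))
  have d2 := (contDiff_der (E := E) (n := n)).comp (contDiff_snd (E := Jet E) (F := Jet E))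
  refine (contDiff_src.comp contDiff_snd).prodMk ((contDiff_tgt.comp contDiff_fst).prodMk
    ((f1.clm_comp f2).prodMk ((l1.clm_comp l2).prodMk (ContDiff.add ?_ ?_))))
  · exact ((ContinuousLinearMap.mul ℝ (End E)).flip.contDiff.comp f2).clm_comp (d1.clm_comp l2)
  · exact ((ContinuousLinearMap.mul ℝ (End E)).contDiff.comp f1).clm_comp d2

theorem contDiffAt_inv [CompleteSpace E] {j : Jet E} (hA : IsUnit j.frame) (hL : IsUnit j.lin) :
    ContDiffAt ℝ n (inv : Jet E → Jet E) j := by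
  have f : ContDiffAt ℝ n (fun j : Jet E => Ring.inverse j.frame) j := by
    obtain ⟨u, hu⟩ := hA
    exact ContDiffAt.comp j (hu ▸ contDiffAt_ringInverse ℝ u) contDiff_frame.contDiffAt
  have l : ContDiffAt ℝ n (fun j : Jet E => Ring.inverse j.lin) j := by
    obtain ⟨u, hu⟩ := hL
    exact ContDiffAt.comp j (hu ▸ contDiffAt_ringInverse ℝ u) contDiff_lin.contDiffAt
  refine contDiff_tgt.contDiffAt.prodMk (contDiff_src.contDiffAt.prodMk
    (f.prodMk (l.prodMk (ContDiffAt.neg ?_))))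
  exact ((ContinuousLinearMap.mul ℝ (End E)).flip.contDiff.contDiffAt.comp j f).clm_comp
    (((ContinuousLinearMap.mul ℝ (End E)).contDiff.contDiffAt.comp j f).clm_comp
      (contDiff_der.contDiffAt.clm_comp l))

end Smooth

end Jet

/-! ### Isomorphisms of frame bundles -/

section FrameIso

variable {Ψ : OpenPartialHomeomorph (FrameSpace E) (FrameSpace E)} {U V : Set E}

theorem IsFrameIso.apply_mem (h : IsFrameIso Ψ U V) {p : FrameSpace E} (hp : p ∈ frames U) :
    Ψ p ∈ frames V :=
  h.target_eq ▸ Ψ.map_source (h.source_eq ▸ hp)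

theorem IsFrameIso.symm (h : IsFrameIso Ψ U V) : IsFrameIso Ψ.symm V U where
  isOpen_left := h.isOpen_right
  isOpen_right := h.isOpen_left
  source_eq := h.target_eq
  target_eq := h.source_eq
  contDiffOn := h.contDiffOn_symm
  contDiffOn_symm := h.contDiffOn
  equivariant p hp g := by
    have hp' : p ∈ Ψ.target := h.target_eq ▸ hp
    have hq : Ψ.symm p ∈ frames U := h.source_eq ▸ Ψ.map_target hp'
    have e := h.equivariant _ hq g
    rw [Ψ.right_inv hp'] at e
    rw [← e, Ψ.left_inv]
    rw [h.source_eq]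
    exact ⟨hq.1, hq.2.mul g.isUnit⟩

/-- By equivariance a change of frame acts on the frame part only; this is what makes the base map
well defined. -/
theorem IsFrameIso.fst_apply (h : IsFrameIso Ψ U V) {x : E} (hx : x ∈ U) {A : End E}
    (hA : IsUnit A) : (Ψ (x, A)).1 = (Ψ (x, 1)).1 := by
  obtain ⟨g, rfl⟩ := hA
  simpa using congrArg Prod.fst (h.equivariant (x, 1) ⟨hx, isUnit_one⟩ g)

theorem IsFrameIso.base_mem (h : IsFrameIso Ψ U V) {x : E} (hx : x ∈ U) : (Ψ (x, 1)).1 ∈ V :=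
  (h.apply_mem (p := (x, 1)) ⟨hx, isUnit_one⟩).1

theorem IsFrameIso.symm_base (h : IsFrameIso Ψ U V) {x : E} (hx : x ∈ U) :
    (Ψ.symm ((Ψ (x, 1)).1, 1)).1 = x := by
  have hm := h.apply_mem (p := (x, 1)) ⟨hx, isUnit_one⟩
  rw [← h.symm.fst_apply hm.1 hm.2]
  exact congrArg Prod.fst (Ψ.left_inv (h.source_eq ▸ ⟨hx, isUnit_one⟩ : (x, (1 : End E)) ∈ Ψ.source))

/-- The diffeomorphism of the bases that is induced by a frame isomorphism. -/
def IsFrameIso.base (h : IsFrameIso Ψ U V) : OpenPartialHomeomorph E E where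
  toFun x := (Ψ (x, 1)).1
  invFun y := (Ψ.symm (y, 1)).1
  source := U
  target := V
  map_source' _ hx := h.base_mem hx
  map_target' _ hy := h.symm.base_mem hy
  left_inv' _ hx := h.symm_base hx
  right_inv' _ hy := h.symm.symm_base hy
  open_source := h.isOpen_left
  open_target := h.isOpen_right
  continuousOn_toFun := continuous_fst.comp_continuousOn <| h.contDiffOn.continuousOn.comp
    (by fun_prop) fun _ hx => ⟨hx, isUnit_one⟩
  continuousOn_invFun := continuous_fst.comp_continuousOn <| h.contDiffOn_symm.continuousOn.comp
    (by fun_prop) fun _ hx => ⟨hx, isUnit_one⟩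

theorem IsFrameIso.contDiffOn_section (h : IsFrameIso Ψ U V) :
    ContDiffOn ℝ ∞ (fun x => Ψ (x, 1)) U :=
  h.contDiffOn.comp (contDiff_id.prodMk contDiff_const).contDiffOn fun _ hx => ⟨hx, isUnit_one⟩

/-- Only derivatives along the section x ↦ (x, 1) enter `frameJet`, so jets can be computed from the
base map and the frame part separately. -/
theorem frameJet_of_differentiableAt {f : FrameSpace E → FrameSpace E} {x : E}
    (h : DifferentiableAt ℝ f (x, 1)) :
    frameJet f x = (x, (f (x, 1)).1, (f (x, 1)).2, fderiv ℝ (fun y => (f (y, 1)).1) x,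
      fderiv ℝ (fun y => (f (y, 1)).2) x) := by
  have hs : HasFDerivAt (fun y : E => f (y, 1))
      ((fderiv ℝ f (x, 1)) ∘L (ContinuousLinearMap.inl ℝ E (End E))) x :=
    HasFDerivAt.comp (g := f) (f := fun y : E => ((y, 1) : FrameSpace E)) x h.hasFDerivAt
      ((hasFDerivAt_id x).prodMk (hasFDerivAt_const (1 : End E) x))
  rw [hs.fst.fderiv, hs.snd.fderiv]
  rfl

theorem IsFrameIso.isUnit_frame (h : IsFrameIso Ψ U V) {x : E} (hx : x ∈ U) :
    IsUnit (frameJet Ψ x).frame :=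
  (h.apply_mem (p := (x, 1)) ⟨hx, isUnit_one⟩).2

/-- The affine isomorphism `p ↦ y + L (p - x)` of `E`. -/
def affineHomeomorph (x y : E) (L : (End E)ˣ) : E ≃ₜ E :=
  ((Homeomorph.subRight x).trans
    (ContinuousLinearEquiv.unitsEquiv ℝ E L).toHomeomorph).trans (Homeomorph.addLeft y)

theorem contDiff_affineHomeomorph (x y : E) (L : (End E)ˣ) :
    ContDiff ℝ ∞ (affineHomeomorph x y L) :=
  contDiff_const.add ((L : End E).contDiff.comp (contDiff_id.sub contDiff_const))

theorem contDiff_affineHomeomorph_symm (x y : E) (L : (End E)ˣ) :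
    ContDiff ℝ ∞ (affineHomeomorph x y L).symm := by
  have e : ⇑(affineHomeomorph x y L).symm =
      fun q => (ContinuousLinearEquiv.unitsEquiv ℝ E L).symm (-y + q) + x := rfl
  rw [e]
  exact ((ContinuousLinearEquiv.contDiff _).comp (contDiff_const.add contDiff_id)).add
    contDiff_const

variable [CompleteSpace E]

theorem IsFrameIso.differentiableAt (h : IsFrameIso Ψ U V) {p : FrameSpace E}
    (hp : p ∈ frames U) : DifferentiableAt ℝ Ψ p :=
  (h.hasFDerivAt hp).differentiableAt

/-- Precomposing with a translation moves the source to 0 and leaves all derivatives unchanged. For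
Ψ = κ̄⁻¹ this computes the jets in the definition of homogeneity. -/
theorem frameJet_comp_frameTransl (h : IsFrameIso Ψ U V) {v : E} (hv : v ∈ U) :
    frameJet (Ψ ∘ frameTransl v) 0 = (0, (Ψ (v, 1)).1, (Ψ (v, 1)).2,
      fderiv ℝ (fun y => (Ψ (y, 1)).1) v, fderiv ℝ (fun y => (Ψ (y, 1)).2) v) := by
  have hd : DifferentiableAt ℝ (Ψ ∘ frameTransl v) ((0 : E), (1 : End E)) := by
    refine DifferentiableAt.comp _ ?_ ?_
    · exact h.differentiableAt (by simpa [frameTransl] using ⟨hv, isUnit_one⟩)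
    · exact (differentiableAt_fst.add_const v).prodMk differentiableAt_snd
  rw [frameJet_of_differentiableAt hd]
  simp only [Function.comp_apply, frameTransl, zero_add]
  rw [fderiv_comp_add_right (f := fun y => (Ψ (y, 1)).1) v,
    fderiv_comp_add_right (f := fun y => (Ψ (y, 1)).2) v, zero_add]

theorem IsFrameIso.frameJet_symm_comp (h : IsFrameIso Ψ U V) {x : E} (hx : x ∈ U) :
    (frameJet Ψ.symm (Ψ (x, 1)).1).lin * (frameJet Ψ x).lin = 1 := by
  have h1 := frameJet_comp h.symm h hx (h.base_mem hx)
  have hx1 : ((x, 1) : FrameSpace E) ∈ frames U := ⟨hx, isUnit_one⟩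
  have he : (Ψ.symm ∘ Ψ) =ᶠ[𝓝 ((x, 1) : FrameSpace E)] id := by
    filter_upwards [(isOpen_frames h.isOpen_left).mem_nhds hx1] with p hp
    exact Ψ.left_inv (h.source_eq ▸ hp)
  have h2 := congrArg Jet.lin h1
  rw [Jet.lin_comp] at h2
  rw [← h2]
  simp only [frameJet, Jet.lin]
  rw [he.fderiv_eq, fderiv_id]
  ext v
  simp

theorem IsFrameIso.isUnit_lin (h : IsFrameIso Ψ U V) {x : E} (hx : x ∈ U) :
    IsUnit (frameJet Ψ x).lin := by
  have h1 := h.frameJet_symm_comp hx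
  have h2 := h.symm.frameJet_symm_comp (h.base_mem hx)
  rw [h.symm_base hx] at h2
  exact ⟨⟨_, _, h2, h1⟩, rfl⟩

/-- The isomorphism `(x, z) ↦ (ψ x, R x * z)` of frame bundles. -/
def frameIso (ψ : OpenPartialHomeomorph E E) (R : E → End E) (hR : ContinuousOn R ψ.source)
    (hu : ∀ x ∈ ψ.source, IsUnit (R x)) :
    OpenPartialHomeomorph (FrameSpace E) (FrameSpace E) where
  toFun p := (ψ p.1, R p.1 * p.2)
  invFun q := (ψ.symm q.1, Ring.inverse (R (ψ.symm q.1)) * q.2)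
  source := frames ψ.source
  target := frames ψ.target
  map_source' p hp := ⟨ψ.map_source hp.1, (hu _ hp.1).mul hp.2⟩
  map_target' q hq := ⟨ψ.map_target hq.1, (hu _ (ψ.map_target hq.1)).ringInverse.mul hq.2⟩
  left_inv' p hp := by
    refine Prod.ext (ψ.left_inv hp.1) ?_
    simp only [ψ.left_inv hp.1, ← mul_assoc, Ring.inverse_mul_cancel _ (hu _ hp.1), one_mul]
  right_inv' q hq := by
    refine Prod.ext (ψ.right_inv hq.1) ?_
    simp only [← mul_assoc, Ring.mul_inverse_cancel _ (hu _ (ψ.map_target hq.1)), one_mul]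
  open_source := isOpen_frames ψ.open_source
  open_target := isOpen_frames ψ.open_target
  continuousOn_toFun :=
    (ψ.continuousOn.comp continuousOn_fst fun _ hp => hp.1).prodMk
      ((hR.comp continuousOn_fst fun _ hp => hp.1).mul continuousOn_snd)
  continuousOn_invFun := by
    have hs : ContinuousOn (fun q : FrameSpace E => ψ.symm q.1) (frames ψ.target) :=
      ψ.continuousOn_symm.comp continuousOn_fst fun _ hp => hp.1
    refine hs.prodMk (ContinuousOn.mul ?_ continuousOn_snd)
    intro q hq
    obtain ⟨u, e⟩ := hu _ (ψ.map_target hq.1)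
    have hi : ContinuousAt Ring.inverse (R (ψ.symm q.1)) := e ▸ NormedRing.inverse_continuousAt u
    exact ContinuousAt.comp_continuousWithinAt (f := fun q : FrameSpace E => R (ψ.symm q.1)) hi
      ((hR.comp hs fun _ hp => ψ.map_target hp.1) q hq)

theorem isFrameIso_frameIso {ψ : OpenPartialHomeomorph E E} {R : E → End E}
    (hψ : ContDiffOn ℝ ∞ ψ ψ.source) (hψ' : ContDiffOn ℝ ∞ ψ.symm ψ.target)
    (hR : ContDiffOn ℝ ∞ R ψ.source) (hu : ∀ x ∈ ψ.source, IsUnit (R x)) :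
    IsFrameIso (frameIso ψ R hR.continuousOn hu) ψ.source ψ.target where
  isOpen_left := ψ.open_source
  isOpen_right := ψ.open_target
  source_eq := rfl
  target_eq := rfl
  contDiffOn :=
    (hψ.comp contDiffOn_fst fun _ hp => hp.1).prodMk
      ((hR.comp contDiffOn_fst fun _ hp => hp.1).clm_comp contDiffOn_snd)
  contDiffOn_symm := by
    have hs : ContDiffOn ℝ ∞ (fun q : FrameSpace E => ψ.symm q.1) (frames ψ.target) :=
      hψ'.comp contDiffOn_fst fun _ hp => hp.1
    refine hs.prodMk (ContDiffOn.clm_comp ?_ contDiffOn_snd)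
    intro q hq
    obtain ⟨u, e⟩ := hu _ (ψ.map_target hq.1)
    have hi : ContDiffAt ℝ ∞ Ring.inverse (R (ψ.symm q.1)) := e ▸ contDiffAt_ringInverse ℝ u
    exact ContDiffAt.comp_contDiffWithinAt (f := fun q : FrameSpace E => R (ψ.symm q.1)) q hi
      ((hR.comp hs fun _ hp => ψ.map_target hp.1) q hq)
  equivariant p _ g := by
    change (ψ p.1, R p.1 * (p.2 * (g : End E))) = (ψ p.1, R p.1 * p.2 * (g : End E))
    rw [mul_assoc]

/-- The first-order Taylor polynomials of the base map and of the frame part realize the jet, on the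
open set where the frame polynomial is invertible. -/
theorem exists_frameJet_eq {j : Jet E} (hA : IsUnit j.frame) (hL : IsUnit j.lin) :
    ∃ (Ψ : OpenPartialHomeomorph (FrameSpace E) (FrameSpace E)) (U V : Set E),
      IsFrameIso Ψ U V ∧ j.src ∈ U ∧ frameJet Ψ j.src = j := by
  obtain ⟨L, hL⟩ := hL
  set R : E → End E := fun p => j.frame + j.der (p - j.src) with hRdef
  have hR : ContDiff ℝ ∞ R :=
    contDiff_const.add (j.der.contDiff.comp (contDiff_id.sub contDiff_const))
  have hO : IsOpen {p | IsUnit (R p)} := Units.isOpen.preimage hR.continuous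
  set ψ : OpenPartialHomeomorph E E :=
    (affineHomeomorph j.src j.tgt L).toOpenPartialHomeomorph.restrOpen _ hO with hψdef
  have hs : ψ.source = {p | IsUnit (R p)} := univ_inter _
  have hI := isFrameIso_frameIso (ψ := ψ) (R := R)
    (contDiff_affineHomeomorph j.src j.tgt L).contDiffOn
    (contDiff_affineHomeomorph_symm j.src j.tgt L).contDiffOn hR.contDiffOn
    (fun x hx => by rw [hs] at hx; exact hx)
  have hm : j.src ∈ ψ.source := by
    rw [hs]
    simpa [hRdef] using hA
  refine ⟨_, _, _, hI, hm, ?_⟩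
  refine (frameJet_of_differentiableAt (hI.differentiableAt ⟨hm, isUnit_one⟩)).trans ?_
  have hsub : HasFDerivAt (fun p : E => p - j.src) (1 : End E) j.src :=
    (hasFDerivAt_id j.src).sub_const j.src
  have h1 : HasFDerivAt (fun p => j.tgt + (L : End E) (p - j.src)) (L : End E) j.src :=
    ((L : End E).hasFDerivAt.comp j.src hsub).const_add j.tgt
  have h2 : HasFDerivAt (fun p => R p * 1) j.der j.src := by
    simp only [mul_one]
    exact (j.der.hasFDerivAt.comp j.src hsub).const_add j.frame
  refine Prod.ext rfl (Prod.ext ?_ (Prod.ext ?_ (Prod.ext ?_ ?_)))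
  · change j.tgt + (L : End E) (j.src - j.src) = j.tgt
    simp
  · change R j.src * 1 = j.frame
    simp [hRdef]
  · exact h1.fderiv.trans hL
  · exact h2.fderiv

/-- This turns the existence of a local isomorphism into an algebraic condition; all later
membership questions about jets go through it. -/
theorem mem_jets_iff {U V : Set E} {j : Jet E} :
    j ∈ jets U V ↔ j.src ∈ U ∧ j.tgt ∈ V ∧ IsUnit j.frame ∧ IsUnit j.lin := by
  constructor
  · rintro ⟨Ψ, U', V', x, h, hx, hxU, hy, rfl⟩
    exact ⟨hxU, hy, h.isUnit_frame hx, h.isUnit_lin hx⟩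
  · rintro ⟨hs, ht, hA, hL⟩
    obtain ⟨Ψ, U', V', h, hx, e⟩ := exists_frameJet_eq hA hL
    refine ⟨Ψ, U', V', j.src, h, hx, hs, ?_, e.symm⟩
    have : (Ψ (j.src, 1)).1 = j.tgt := congrArg Jet.tgt e
    rwa [this]

theorem comp_mem_jets {U V X Y : Set E} {k j : Jet E} (hk : k ∈ jets X Y) (hj : j ∈ jets U V) :
    k.comp j ∈ jets U Y := by
  rw [mem_jets_iff] at *
  exact ⟨hj.1, hk.2.1, hk.2.2.1.mul hj.2.2.1, hk.2.2.2.mul hj.2.2.2⟩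

end FrameIso

/-! ### The uniform references and their group -/

theorem Jet.eq_inv {j k : Jet E} (hA : IsUnit j.frame) (hL : IsUnit j.lin) (h : k.src = j.tgt)
    (hk : k.comp j = idAt j.src) : k = j.inv := by
  rw [← comp_idAt h, ← comp_inv hA hL, ← comp_assoc, hk, idAt_comp (tgt_inv j)]

theorem Jet.comp_inv_comp {j k : Jet E} (hA : IsUnit j.frame) (hL : IsUnit j.lin)
    (h : k.tgt = j.tgt) : j.comp (j.inv.comp k) = k := by
  rw [← comp_assoc, comp_inv hA hL, idAt_comp h]

theorem Jet.inv_comp_comp {j k : Jet E} (hA : IsUnit j.frame) (hL : IsUnit j.lin)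
    (h : k.tgt = j.src) : j.inv.comp (j.comp k) = k := by
  rw [← comp_assoc, inv_comp hA hL, idAt_comp h]

/-- The composition of jets does not depend on the intermediate point. -/
theorem Jet.comp_congr_mid {k j j' : Jet E} (h : j.src = j'.src) (h' : j.2.2 = j'.2.2) :
    k.comp j = k.comp j' := by
  obtain ⟨a, b, c⟩ := j
  obtain ⟨a', b', c'⟩ := j'
  simp only [Jet.src] at h
  simp only at h'
  subst h h'
  rfl

/-- A differentiable local right inverse of φ through a makes the derivative of φ at a surjective,
and surjections compose. -/
theorem surjective_fderiv_comp_of_rightInverse {F G K : Type*} [NormedAddCommGroup F]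
    [NormedSpace ℝ F] [NormedAddCommGroup G] [NormedSpace ℝ G] [NormedAddCommGroup K]
    [NormedSpace ℝ K] {f : G → K} {φ : F → G} {g : G → F} {a : F}
    (hf : DifferentiableAt ℝ f (φ a)) (hfs : Function.Surjective (fderiv ℝ f (φ a)))
    (hφ : DifferentiableAt ℝ φ a) (hg : DifferentiableAt ℝ g (φ a)) (hab : g (φ a) = a)
    (h : ∀ᶠ y in 𝓝 (φ a), φ (g y) = y) : Function.Surjective (fderiv ℝ (f ∘ φ) a) := by
  rw [fderiv_comp a hf hφ]
  refine hfs.comp ?_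
  have hφ' : HasFDerivAt φ (fderiv ℝ φ a) (g (φ a)) := hab.symm ▸ hφ.hasFDerivAt
  have h1 := (hφ'.comp (φ a) hg.hasFDerivAt).congr_of_eventuallyEq
    (f₁ := id) (h.mono fun y hy => hy.symm)
  have h2 := h1.unique (hasFDerivAt_id (φ a))
  exact fun y => ⟨fderiv ℝ g (φ a) y, DFunLike.congr_fun h2 y⟩

/-- If `g` is a submersion at `p` and vanishes on the image of a section of the linear map `π`,
translated to `p`, then `π` and `g` together form a submersion at `p`. -/
theorem exists_submersion_prod {M X K : Type*} [NormedAddCommGroup M] [NormedSpace ℝ M]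
    [NormedAddCommGroup X] [NormedSpace ℝ X] [NormedAddCommGroup K] [NormedSpace ℝ K]
    [FiniteDimensional ℝ X] [FiniteDimensional ℝ K] {g : M → K} {p : M} {N : Set M}
    (hN : IsOpen N) (hp : p ∈ N) (hg : ContDiffOn ℝ ∞ g N)
    (hgs : Function.Surjective (fderiv ℝ g p)) (π : M →L[ℝ] X) (s : X →L[ℝ] M)
    (hπ : ∀ x, π (s x) = x) (h : ∀ᶠ x in 𝓝 (0 : X), g (p + s x) = 0) :
    ∃ (n : ℕ) (f : M → (Fin n → ℝ)), ContDiffOn ℝ ∞ f N ∧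
      Function.Surjective (fderiv ℝ f p) ∧ ∀ q, f q = 0 ↔ π q = 0 ∧ g q = 0 := by
  have hgd : HasFDerivAt g (fderiv ℝ g p) p :=
    ((hg.contDiffAt (hN.mem_nhds hp)).differentiableAt (by simp)).hasFDerivAt
  -- Near p, g is constant along the image of s, so its derivative at p kills that image.
  have hzero : ∀ x, fderiv ℝ g p (s x) = 0 := by
    intro x
    have hgd' : HasFDerivAt g (fderiv ℝ g p) (p + s 0) := by rwa [map_zero, add_zero]
    have hc := hgd'.comp (0 : X) (s.hasFDerivAt.const_add p)
    have h3 := (hc.congr_of_eventuallyEq (f₁ := fun _ => 0) (h.mono fun q hq => hq.symm)).unique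
      (hasFDerivAt_const _ _)
    exact DFunLike.congr_fun h3 x
  set e : (X × K) ≃L[ℝ] (Fin (Module.finrank ℝ (X × K)) → ℝ) :=
    ContinuousLinearEquiv.ofFinrankEq (by simp)
  refine ⟨_, fun q => e (π q, g q), ?_, ?_, fun q => ?_⟩
  · exact e.contDiff.comp_contDiffOn (π.contDiff.contDiffOn.prodMk hg)
  · have hF := (e.hasFDerivAt.comp p (π.hasFDerivAt.prodMk hgd)).fderiv
    simp only [Function.comp_def] at hF
    rw [hF]
    refine e.surjective.comp ?_
    rintro ⟨x, c⟩
    obtain ⟨w, hw⟩ := hgs c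
    -- w gives the right value of dg; the correction along s adjusts π and is invisible to dg by
    -- `hzero`.
    refine ⟨w + s (x - π w), Prod.ext ?_ ?_⟩
    · change π (w + s (x - π w)) = x
      rw [map_add, hπ, add_sub_cancel]
    · change fderiv ℝ g p (w + s (x - π w)) = c
      rw [map_add, hzero, hw, add_zero]
  · rw [map_eq_zero_iff e e.injective]
    simp [Prod.ext_iff]

/-! ### Conjugation by a moving frame -/

section Conj

variable {σ : E → Jet E}

/-- The conjugation by a section `σ` of `F̄²B`, extended to jets with arbitrary source and
target. -/
def conjSection (z : E) (σ : E → Jet E) (h : Jet E) : Jet E :=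
  (σ (z + h.tgt)).comp (h.comp (σ (z + h.src)).inv)

/-- The inverse of `conjSection`. -/
def conjSectionInv (z : E) (σ : E → Jet E) (j : Jet E) : Jet E :=
  (j.src - z, j.tgt - z, ((σ j.tgt).inv.comp (j.comp (σ j.src))).2.2)

theorem conjSection_conjSectionInv {z : E} {j : Jet E} (hs : IsUnit (σ j.src).frame)
    (hs' : IsUnit (σ j.src).lin) (ht : IsUnit (σ j.tgt).frame) (ht' : IsUnit (σ j.tgt).lin)
    (h1 : (σ j.src).tgt = j.src) (h2 : (σ j.tgt).tgt = j.tgt) :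
    conjSection z σ (conjSectionInv z σ j) = j := by
  have e1 : z + (conjSectionInv z σ j).src = j.src := add_sub_cancel _ _
  have e2 : z + (conjSectionInv z σ j).tgt = j.tgt := add_sub_cancel _ _
  -- The jet σ⁻¹ j σ had its end points overwritten to remember those of j. Here only the target
  -- differs, and it becomes an intermediate point that composition ignores.
  have e3 : (conjSectionInv z σ j).comp (σ j.src).inv =
      (j.src, j.tgt - z, (((σ j.tgt).inv.comp (j.comp (σ j.src))).comp (σ j.src).inv).2.2) :=
    Prod.ext h1 rfl
  rw [conjSection, e1, e2, Jet.comp_congr_mid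
    (j := (conjSectionInv z σ j).comp (σ j.src).inv)
    (j' := ((σ j.tgt).inv.comp (j.comp (σ j.src))).comp (σ j.src).inv) rfl (by rw [e3])]
  rw [Jet.comp_assoc, Jet.comp_assoc, Jet.comp_inv hs hs', h1, Jet.comp_idAt rfl,
    Jet.comp_inv_comp ht ht' h2.symm]

theorem conjSectionInv_conjSection {z : E} {h : Jet E} (hs : h.src = 0) (ht : h.tgt = 0)
    (h0 : (σ z).src = 0) (hz : (σ z).tgt = z) (hA : IsUnit (σ z).frame) (hL : IsUnit (σ z).lin) :
    conjSectionInv z σ (conjSection z σ h) = h := by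
  have e : conjSection z σ h = (σ z).comp (h.comp (σ z).inv) := by
    rw [conjSection, hs, ht, add_zero]
  rw [e, conjSectionInv]
  simp only [Jet.src_comp, Jet.tgt_comp, Jet.src_inv, hz, Jet.comp_assoc]
  rw [Jet.inv_comp hA hL, h0, Jet.comp_idAt hs, Jet.inv_comp_comp hA hL (ht.trans h0.symm),
    sub_self]
  exact Prod.ext hs.symm (Prod.ext ht.symm rfl)

end Conj

/-- The source and the target of a jet, as a linear map. -/
def Jet.endpoints (E : Type*) [NormedAddCommGroup E] [NormedSpace ℝ E] : Jet E →L[ℝ] E × E :=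
  (ContinuousLinearMap.fst ℝ E _).prod
    ((ContinuousLinearMap.fst ℝ E _) ∘L (ContinuousLinearMap.snd ℝ E _))

/-- The linear section of `Jet.endpoints` with vanishing other components. -/
def Jet.ofEndpoints (E : Type*) [NormedAddCommGroup E] [NormedSpace ℝ E] : E × E →L[ℝ] Jet E :=
  (ContinuousLinearMap.fst ℝ E E).prod ((ContinuousLinearMap.snd ℝ E E).prod 0)

/-! ### Uniform references as cosets of the crystal group -/

section Material

variable [CompleteSpace E] {V : Type*} {B : Set E} {W : Jet E → V} {Z₀ : Jet E}

theorem IsLieSubgroupoid.isUnit {Γ : Set (Jet E)} (hΓ : IsLieSubgroupoid B Γ) {j : Jet E}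
    (hj : j ∈ Γ) : IsUnit j.frame ∧ IsUnit j.lin :=
  (mem_jets_iff.1 (hΓ.subset hj)).2.2

/-- Inverses are unique, so the inverse provided by the groupoid axiom is `Jet.inv`. -/
theorem IsLieSubgroupoid.jet_inv_mem {Γ : Set (Jet E)} (hΓ : IsLieSubgroupoid B Γ) {j : Jet E}
    (hj : j ∈ Γ) : j.inv ∈ Γ := by
  obtain ⟨k, hk, h1, h2⟩ := hΓ.inv_mem j hj
  have hu := hΓ.isUnit hj
  rwa [← Jet.eq_inv (k := k) hu.1 hu.2 (congrArg Jet.src h2) h1]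

theorem uniformReferences_subset (hΩ : IsLieSubgroupoid B (materialGroupoid B W))
    (hZ₀ : Z₀ ∈ nonholonomicFrames B) : uniformReferences B W Z₀ ⊆ nonholonomicFrames B := by
  rintro _ ⟨g, hg, -, rfl⟩
  exact comp_mem_jets (hΩ.subset hg) hZ₀

theorem mem_uniformReferences_self (hΩ : IsLieSubgroupoid B (materialGroupoid B W))
    (hZ₀ : Z₀ ∈ nonholonomicFrames B) : Z₀ ∈ uniformReferences B W Z₀ :=
  ⟨Jet.idAt Z₀.tgt, hΩ.id_mem _ (mem_jets_iff.1 hZ₀).2.1, rfl, (Jet.idAt_comp rfl).symm⟩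

/-- If Y = g Z₀ and Z = k Z₀, then Y Z⁻¹ = g k⁻¹. -/
theorem comp_inv_mem_materialGroupoid (hΩ : IsLieSubgroupoid B (materialGroupoid B W))
    (hZ₀ : Z₀ ∈ nonholonomicFrames B) {Y Z : Jet E} (hY : Y ∈ uniformReferences B W Z₀)
    (hZ : Z ∈ uniformReferences B W Z₀) : Y.comp Z.inv ∈ materialGroupoid B W := by
  obtain ⟨-, -, hA, hL⟩ := mem_jets_iff.1 (uniformReferences_subset hΩ hZ₀ hZ)
  obtain ⟨g, hg, hgs, rfl⟩ := hY
  obtain ⟨k, hk, hks, rfl⟩ := hZ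
  have hu := hΩ.isUnit hk
  have e : g.comp Z₀ = (g.comp k.inv).comp (k.comp Z₀) := by
    rw [Jet.comp_assoc, Jet.inv_comp_comp hu.1 hu.2 hks.symm]
  rw [e, Jet.comp_assoc, Jet.comp_inv hA hL,
    Jet.comp_idAt (show (g.comp k.inv).src = (k.comp Z₀).tgt from rfl)]
  exact hΩ.comp_mem _ hg _ (hΩ.jet_inv_mem hk) (hgs.trans hks.symm)

/-- Right translation by Z₀⁻¹ recovers the material isomorphism. The condition on the source is
separate because composition with Z₀⁻¹ forgets it. -/
theorem mem_uniformReferences_iff (hZ₀ : Z₀ ∈ nonholonomicFrames B) {Z : Jet E} :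
    Z ∈ uniformReferences B W Z₀ ↔ Z.src = 0 ∧ Z.comp Z₀.inv ∈ materialGroupoid B W := by
  obtain ⟨h0, -, hA, hL⟩ := mem_jets_iff.1 hZ₀
  constructor
  · rintro ⟨g, hg, hgs, rfl⟩
    refine ⟨h0, ?_⟩
    rwa [Jet.comp_assoc, Jet.comp_inv hA hL, Jet.comp_idAt hgs]
  · rintro ⟨hs, hm⟩
    refine ⟨_, hm, rfl, ?_⟩
    rw [Jet.comp_assoc, Jet.inv_comp hA hL, Jet.comp_idAt (hs.trans h0.symm)]

/-- Y' h Z'⁻¹ = (Y' Y⁻¹)(Y h Z⁻¹)(Z Z'⁻¹), and the outer factors are material isomorphisms. -/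
theorem conj_mem_of_conj_mem (hΩ : IsLieSubgroupoid B (materialGroupoid B W))
    (hZ₀ : Z₀ ∈ nonholonomicFrames B) {Y Z Y' Z' h : Jet E} (hY : Y ∈ uniformReferences B W Z₀)
    (hZ : Z ∈ uniformReferences B W Z₀) (hY' : Y' ∈ uniformReferences B W Z₀)
    (hZ' : Z' ∈ uniformReferences B W Z₀) (ht : h.tgt = 0)
    (hm : Y.comp (h.comp Z.inv) ∈ materialGroupoid B W) :
    Y'.comp (h.comp Z'.inv) ∈ materialGroupoid B W := by
  obtain ⟨hy, -, hYA, hYL⟩ := mem_jets_iff.1 (uniformReferences_subset hΩ hZ₀ hY)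
  obtain ⟨hz, -, hZA, hZL⟩ := mem_jets_iff.1 (uniformReferences_subset hΩ hZ₀ hZ)
  obtain ⟨hz', -, -, -⟩ := mem_jets_iff.1 (uniformReferences_subset hΩ hZ₀ hZ')
  have e : Y'.comp (h.comp Z'.inv) =
      (Y'.comp Y.inv).comp ((Y.comp (h.comp Z.inv)).comp (Z.comp Z'.inv)) := by
    have hz0 : Z'.inv.tgt = Z.src := hz'.trans hz.symm
    simp only [Jet.comp_assoc]
    rw [Jet.inv_comp_comp hZA hZL hz0, Jet.inv_comp_comp hYA hYL]
    exact ht.trans hy.symm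
  rw [e]
  refine hΩ.comp_mem _ (comp_inv_mem_materialGroupoid hΩ hZ₀ hY' hY) _ ?_ rfl
  exact hΩ.comp_mem _ hm _ (comp_inv_mem_materialGroupoid hΩ hZ₀ hZ hZ') rfl

/-- Ḡ₀ can be tested with any two uniform references, even at different points of the body. This
freedom is what allows the end points to move in the submanifold argument. -/
theorem mem_crystalGroup_iff (hΩ : IsLieSubgroupoid B (materialGroupoid B W))
    (hZ₀ : Z₀ ∈ nonholonomicFrames B) {Y Z h : Jet E} (hY : Y ∈ uniformReferences B W Z₀)
    (hZ : Z ∈ uniformReferences B W Z₀) :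
    h ∈ crystalGroup B W Z₀ ↔
      h.src = 0 ∧ h.tgt = 0 ∧ Y.comp (h.comp Z.inv) ∈ materialGroupoid B W := by
  obtain ⟨h0, -, hA, hL⟩ := mem_jets_iff.1 hZ₀
  have hm := mem_uniformReferences_self hΩ hZ₀
  constructor
  · rintro ⟨hn, g, hg, hgs, hgt, e⟩
    obtain ⟨hs, ht, -, -⟩ := mem_jets_iff.1 hn
    refine ⟨hs, ht, conj_mem_of_conj_mem hΩ hZ₀ hm hm hY hZ ht ?_⟩
    rwa [← Jet.comp_assoc, e, Jet.comp_assoc, Jet.comp_inv hA hL, Jet.comp_idAt hgs]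
  · rintro ⟨hs, ht, hc⟩
    have hc' := conj_mem_of_conj_mem hΩ hZ₀ hY hZ hm hm ht hc
    obtain ⟨hcA, hcL⟩ := hΩ.isUnit hc'
    have hA' : IsUnit Z₀.inv.frame := hA.ringInverse
    have hL' : IsUnit Z₀.inv.lin := hL.ringInverse
    refine ⟨mem_jets_iff.2 ⟨hs, ht, ?_, ?_⟩, _, hc', rfl, rfl, ?_⟩
    -- Invertibility of Z₀ h Z₀⁻¹ passes to h by cancelling the outer units; the linear part is
    -- treated alike.
    · rw [Jet.frame_comp, Jet.frame_comp] at hcA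
      obtain ⟨a, ha⟩ := hA
      obtain ⟨b, hb⟩ := hA'
      rw [← ha, ← hb] at hcA
      simpa using hcA
    · rw [Jet.lin_comp, Jet.lin_comp] at hcL
      obtain ⟨a, ha⟩ := hL
      obtain ⟨b, hb⟩ := hL'
      rw [← ha, ← hb] at hcL
      simpa using hcL
    · rw [Jet.comp_assoc, Jet.comp_assoc, Jet.inv_comp hA hL, Jet.comp_idAt (hs.trans h0.symm)]

/-- The candidate is g = Y⁻¹ Z; tested with the pair Y, Z it gives Y g Z⁻¹ = 1, which is in the
groupoid. -/
theorem mem_uniformReferences_iff_exists (hΩ : IsLieSubgroupoid B (materialGroupoid B W))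
    (hZ₀ : Z₀ ∈ nonholonomicFrames B) {Y Z : Jet E} (hY : Y ∈ uniformReferences B W Z₀)
    (hZ : Z ∈ nonholonomicFrames B) (h : Y.tgt = Z.tgt) :
    Z ∈ uniformReferences B W Z₀ ↔ ∃ g ∈ crystalGroup B W Z₀, Z = Y.comp g := by
  obtain ⟨hy, -, hYA, hYL⟩ := mem_jets_iff.1 (uniformReferences_subset hΩ hZ₀ hY)
  obtain ⟨hz, hzB, hZA, hZL⟩ := mem_jets_iff.1 hZ
  have e : Y.comp (Y.inv.comp Z) = Z := Jet.comp_inv_comp hYA hYL h.symm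
  constructor
  · intro hZS
    refine ⟨Y.inv.comp Z, (mem_crystalGroup_iff hΩ hZ₀ hY hZS).2 ⟨hz, hy, ?_⟩, e.symm⟩
    rw [← Jet.comp_assoc, e, Jet.comp_inv hZA hZL]
    exact hΩ.id_mem _ hzB
  · rintro ⟨g, hg, rfl⟩
    rw [mem_uniformReferences_iff hZ₀, Jet.comp_assoc]
    exact ⟨hz, ((mem_crystalGroup_iff hΩ hZ₀ hY (mem_uniformReferences_self hΩ hZ₀)).1 hg).2.2⟩

/-- A smooth section of the uniform references over the whole body. -/
structure IsUniformSection (B : Set E) (W : Jet E → V) (Z₀ : Jet E) (σ : E → Jet E) : Prop where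
  contDiffOn : ContDiffOn ℝ ∞ σ B
  mem : ∀ y ∈ B, σ y ∈ uniformReferences B W Z₀
  tgt : ∀ y ∈ B, (σ y).tgt = y

/-! ### The crystal group as a Lie subgroup, and the Ḡ₀-structure -/

section Submanifold

variable {σ : E → Jet E}

theorem contDiffAt_conjSection {z : E} {h : Jet E} (hs : ContDiffAt ℝ ∞ σ (z + h.src))
    (ht : ContDiffAt ℝ ∞ σ (z + h.tgt)) (hA : IsUnit (σ (z + h.src)).frame)
    (hL : IsUnit (σ (z + h.src)).lin) : ContDiffAt ℝ ∞ (conjSection z σ) h := by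
  have f1 : ContDiffAt ℝ ∞ (fun h : Jet E => σ (z + h.tgt)) h :=
    ht.comp h (contDiff_const.add Jet.contDiff_tgt).contDiffAt
  have f2 : ContDiffAt ℝ ∞ (fun h : Jet E => σ (z + h.src)) h :=
    hs.comp h (contDiff_const.add Jet.contDiff_src).contDiffAt
  have f3 : ContDiffAt ℝ ∞ (fun h : Jet E => (σ (z + h.src)).inv) h :=
    ContDiffAt.comp (g := Jet.inv) h (Jet.contDiffAt_inv hA hL) f2
  exact Jet.contDiff_comp.contDiffAt.comp h
    (f1.prodMk (Jet.contDiff_comp.contDiffAt.comp h (contDiffAt_id.prodMk f3)))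

theorem contDiffAt_conjSectionInv {z : E} {j : Jet E} (hs : ContDiffAt ℝ ∞ σ j.src)
    (ht : ContDiffAt ℝ ∞ σ j.tgt) (hA : IsUnit (σ j.tgt).frame)
    (hL : IsUnit (σ j.tgt).lin) : ContDiffAt ℝ ∞ (conjSectionInv z σ) j := by
  have f1 : ContDiffAt ℝ ∞ (fun h : Jet E => σ h.tgt) j :=
    ht.comp j Jet.contDiff_tgt.contDiffAt
  have f2 : ContDiffAt ℝ ∞ (fun h : Jet E => σ h.src) j :=
    hs.comp j Jet.contDiff_src.contDiffAt
  have f3 : ContDiffAt ℝ ∞ (fun h : Jet E => (σ h.tgt).inv) j :=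
    ContDiffAt.comp (g := Jet.inv) j (Jet.contDiffAt_inv hA hL) f1
  have f4 : ContDiffAt ℝ ∞ (fun j : Jet E => (σ j.tgt).inv.comp (j.comp (σ j.src))) j :=
    Jet.contDiff_comp.contDiffAt.comp j
      (f3.prodMk (Jet.contDiff_comp.contDiffAt.comp j (contDiffAt_id.prodMk f2)))
  exact (Jet.contDiff_src.contDiffAt.sub contDiffAt_const).prodMk
    ((Jet.contDiff_tgt.contDiffAt.sub contDiffAt_const).prodMk f4.snd.snd)

theorem IsUniformSection.isUnit (hσ : IsUniformSection B W Z₀ σ)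
    (hΩ : IsLieSubgroupoid B (materialGroupoid B W)) (hZ₀ : Z₀ ∈ nonholonomicFrames B) {y : E}
    (hy : y ∈ B) : (σ y).src = 0 ∧ IsUnit (σ y).frame ∧ IsUnit (σ y).lin :=
  have h := mem_jets_iff.1 (uniformReferences_subset hΩ hZ₀ (hσ.mem y hy))
  ⟨h.1, h.2.2⟩

/-- Let Φ be conjugation by σ and f a defining function of the groupoid at Φ(h₀). Then f ∘ Φ is a
submersion at h₀ that does not see shifts of the end points of h₀, so the pair (end points, f ∘ Φ)
is still a submersion at h₀, and its zero set near h₀ is Ḡ₀. -/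
theorem isEmbeddedSubmanifold_crystalGroup [FiniteDimensional ℝ E] (hB : IsOpen B)
    (hΩ : IsLieSubgroupoid B (materialGroupoid B W)) (hZ₀ : Z₀ ∈ nonholonomicFrames B)
    (hσ : IsUniformSection B W Z₀ σ) : IsEmbeddedSubmanifold (crystalGroup B W Z₀) := by
  intro h₀ hh₀
  set z := Z₀.tgt with hz
  have hzB : z ∈ B := (mem_jets_iff.1 hZ₀).2.1
  have hcd : ∀ y ∈ B, ContDiffAt ℝ ∞ σ y := fun y hy => hσ.contDiffOn.contDiffAt (hB.mem_nhds hy)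
  have hmem : ∀ h : Jet E, z + h.src ∈ B → z + h.tgt ∈ B →
      (h.src = 0 ∧ h.tgt = 0 ∧ conjSection z σ h ∈ materialGroupoid B W ↔
        h ∈ crystalGroup B W Z₀) := fun h h1 h2 =>
    (mem_crystalGroup_iff hΩ hZ₀ (hσ.mem _ h2) (hσ.mem _ h1)).symm
  set O : Set (Jet E) := {h | z + h.src ∈ B ∧ z + h.tgt ∈ B} with hO
  have hOo : IsOpen O :=
    (hB.preimage (continuous_const.add (Jet.contDiff_src (n := 0)).continuous)).inter
      (hB.preimage (continuous_const.add (Jet.contDiff_tgt (n := 0)).continuous))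
  obtain ⟨hs, ht, -, -⟩ := mem_jets_iff.1 hh₀.1
  simp only [mem_singleton_iff] at hs ht
  have hh₀O : h₀ ∈ O := by
    simp only [hO, mem_ofPred_eq, hs, ht, add_zero]
    exact ⟨hzB, hzB⟩
  have hΦ : ∀ h ∈ O, ContDiffAt ℝ ∞ (conjSection z σ) h := fun h hh =>
    contDiffAt_conjSection (hcd _ hh.1) (hcd _ hh.2) (hσ.isUnit hΩ hZ₀ hh.1).2.1
      (hσ.isUnit hΩ hZ₀ hh.1).2.2
  have hp : conjSection z σ h₀ ∈ materialGroupoid B W := ((hmem h₀ hh₀O.1 hh₀O.2).2 hh₀).2.2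
  obtain ⟨k, f, N, hN, hpN, hf, hfs, hfN⟩ := hΩ.submanifold _ hp
  obtain ⟨h0, hA, hL⟩ := hσ.isUnit hΩ hZ₀ hzB
  have hps : (conjSection z σ h₀).src = z := by
    change (σ (z + h₀.src)).tgt = z
    rw [hσ.tgt _ hh₀O.1, hs, add_zero]
  have hpt : (conjSection z σ h₀).tgt = z := by
    change (σ (z + h₀.tgt)).tgt = z
    rw [hσ.tgt _ hh₀O.2, ht, add_zero]
  have hgs : Function.Surjective (fderiv ℝ (f ∘ conjSection z σ) h₀) := by
    refine surjective_fderiv_comp_of_rightInverse (g := conjSectionInv z σ)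
      ((hf.contDiffAt (hN.mem_nhds hpN)).differentiableAt (by simp)) hfs
      ((hΦ h₀ hh₀O).differentiableAt (by simp)) ?_ ?_ ?_
    · refine (contDiffAt_conjSectionInv ?_ ?_ ?_ ?_).differentiableAt (by simp)
      · rw [hps]; exact hcd _ hzB
      · rw [hpt]; exact hcd _ hzB
      · rw [hpt]; exact hA
      · rw [hpt]; exact hL
    · exact conjSectionInv_conjSection hs ht h0 (hσ.tgt z hzB) hA hL
    · have o : IsOpen {j : Jet E | j.src ∈ B ∧ j.tgt ∈ B} :=
        (hB.preimage (Jet.contDiff_src (n := 0)).continuous).inter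
          (hB.preimage (Jet.contDiff_tgt (n := 0)).continuous)
      filter_upwards [o.mem_nhds ⟨hps.symm ▸ hzB, hpt.symm ▸ hzB⟩] with j hj
      have u1 := hσ.isUnit hΩ hZ₀ hj.1
      have u2 := hσ.isUnit hΩ hZ₀ hj.2
      exact conjSection_conjSectionInv u1.2.1 u1.2.2 u2.2.1 u2.2.2 (hσ.tgt _ hj.1) (hσ.tgt _ hj.2)
  set N' : Set (Jet E) := O ∩ conjSection z σ ⁻¹' N with hN'
  have hN'o : IsOpen N' :=
    ContinuousOn.isOpen_inter_preimage
      (fun h hh => (hΦ h hh).continuousAt.continuousWithinAt) hOo hN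
  have hh₀N' : h₀ ∈ N' := ⟨hh₀O, hpN⟩
  have hgc : ContDiffOn ℝ ∞ (f ∘ conjSection z σ) N' := fun h hh =>
    ((hf.contDiffAt (hN.mem_nhds hh.2)).comp h (hΦ h hh.1)).contDiffWithinAt
  -- Shifting the end points of h₀ only changes the points at which σ is evaluated; by
  -- `mem_crystalGroup_iff` the conjugate of h₀ stays in the groupoid.
  have hev : ∀ᶠ x in 𝓝 (0 : E × E), (f ∘ conjSection z σ) (h₀ + Jet.ofEndpoints E x) = 0 := by
    have hcont : Continuous (fun x : E × E => h₀ + Jet.ofEndpoints E x) :=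
      continuous_const.add (Jet.ofEndpoints E).continuous
    have hN'n : N' ∈ 𝓝 (h₀ + Jet.ofEndpoints E 0) := by
      rw [map_zero, add_zero]
      exact hN'o.mem_nhds hh₀N'
    filter_upwards [hcont.tendsto 0 hN'n] with x hx
    have hxN' : h₀ + Jet.ofEndpoints E x ∈ N' := hx
    refine (hfN _ hxN'.2).1 ?_
    have e : h₀ + Jet.ofEndpoints E x = (h₀.src + x.1, h₀.tgt + x.2, h₀.2.2) :=
      Prod.ext rfl (Prod.ext rfl (add_zero _))
    rw [e] at hxN' ⊢
    exact ((mem_crystalGroup_iff hΩ hZ₀ (hσ.mem _ hxN'.1.2) (hσ.mem _ hxN'.1.1)).1 hh₀).2.2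
  obtain ⟨n, F, hFc, hFs, hF⟩ := exists_submersion_prod hN'o hh₀N' hgc hgs (Jet.endpoints E)
    (Jet.ofEndpoints E) (fun _ => rfl) hev
  refine ⟨n, F, N', hN'o, hh₀N', hFc, hFs, fun q hq => ?_⟩
  have e : Jet.endpoints E q = 0 ↔ q.src = 0 ∧ q.tgt = 0 := Prod.ext_iff
  rw [hF, ← hmem q hq.1.1 hq.1.2, hfN _ hq.2, e, and_assoc]
  rfl

theorem isLieSubgroup_crystalGroup [FiniteDimensional ℝ E] (hB : IsOpen B)
    (hΩ : IsLieSubgroupoid B (materialGroupoid B W)) (hZ₀ : Z₀ ∈ nonholonomicFrames B)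
    (hσ : IsUniformSection B W Z₀ σ) : IsLieSubgroup (crystalGroup B W Z₀) := by
  obtain ⟨h0, hzB, hA, hL⟩ := mem_jets_iff.1 hZ₀
  have hm := mem_uniformReferences_self hΩ hZ₀
  have hiff : ∀ {h}, h ∈ crystalGroup B W Z₀ ↔ _ := mem_crystalGroup_iff hΩ hZ₀ hm hm
  have ht0 : Z₀.inv.tgt = 0 := h0
  refine ⟨fun h hh => hh.1, hiff.2 ⟨rfl, rfl, ?_⟩, fun g hg h hh => ?_, fun g hg => ?_,
    isEmbeddedSubmanifold_crystalGroup hB hΩ hZ₀ hσ⟩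
  · rw [Jet.idAt_comp ht0, Jet.comp_inv hA hL]
    exact hΩ.id_mem _ hzB
  · obtain ⟨-, gt, gm⟩ := hiff.1 hg
    obtain ⟨hs, ht, hhm⟩ := hiff.1 hh
    refine hiff.2 ⟨hs, gt, ?_⟩
    have := hΩ.comp_mem _ gm _ hhm rfl
    rwa [Jet.comp_assoc, Jet.comp_assoc, Jet.inv_comp_comp hA hL, ← Jet.comp_assoc g] at this
    exact ht.trans h0.symm
  · obtain ⟨gs, gt, gA, gL⟩ := mem_jets_iff.1 hg.1
    have gs : g.src = 0 := gs
    have gt : g.tgt = 0 := gt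
    obtain ⟨-, -, gm⟩ := hiff.1 hg
    have e1 := Jet.inv_comp gA gL
    have e2 := Jet.comp_inv gA gL
    rw [gs] at e1
    rw [gt] at e2
    refine ⟨g.inv, hiff.2 ⟨gt, gs, ?_⟩, e1, e2⟩
    have hu := hΩ.isUnit gm
    -- Conjugation by Z₀ commutes with inversion, so closure follows from that of the groupoid.
    have e : Z₀.comp (g.inv.comp Z₀.inv) = (Z₀.comp (g.comp Z₀.inv)).inv := by
      refine Jet.eq_inv hu.1 hu.2 rfl ?_
      rw [Jet.comp_assoc, Jet.comp_assoc, Jet.inv_comp_comp hA hL (k := g.comp Z₀.inv)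
        (gt.trans h0.symm),
        Jet.inv_comp_comp gA gL (k := Z₀.inv) (ht0.trans gs.symm), Jet.comp_inv hA hL]
      rfl
    rw [e]
    exact hΩ.jet_inv_mem gm

theorem IsUniformSection.isGStructure [FiniteDimensional ℝ E] (hσ : IsUniformSection B W Z₀ σ)
    (hB : IsOpen B) (hΩ : IsLieSubgroupoid B (materialGroupoid B W))
    (hZ₀ : Z₀ ∈ nonholonomicFrames B) :
    IsGStructure B (crystalGroup B W Z₀) (uniformReferences B W Z₀) where
  group := isLieSubgroup_crystalGroup hB hΩ hZ₀ hσ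
  subset := uniformReferences_subset hΩ hZ₀
  locally_trivial _ hx := ⟨B, hB, hx, subset_rfl, σ, hσ.contDiffOn,
    fun y hy => ⟨uniformReferences_subset hΩ hZ₀ (hσ.mem y hy), hσ.tgt y hy⟩,
    fun _ hZ hZB =>
      mem_uniformReferences_iff_exists hΩ hZ₀ (hσ.mem _ hZB) hZ (hσ.tgt _ hZB)⟩

end Submanifold

/-! ### Homogeneity and integrable prolongations -/

theorem IsHomogeneous.isIntegrableProlongation [FiniteDimensional ℝ E] (hB : IsOpen B)
    (hΩ : IsLieSubgroupoid B (materialGroupoid B W)) (hZ₀ : Z₀ ∈ nonholonomicFrames B)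
    (h : IsHomogeneous B W Z₀) :
    IsIntegrableProlongation B (crystalGroup B W Z₀) (uniformReferences B W Z₀) := by
  obtain ⟨κ, U', hκ, hm⟩ := h
  set ψ := hκ.base with hψ
  set R : E → End E := fun y => (κ.symm (y, 1)).2 with hR
  have hψs : ContDiffOn ℝ ∞ ψ B := contDiff_fst.comp_contDiffOn hκ.contDiffOn_section
  have hψt : ContDiffOn ℝ ∞ ψ.symm U' := contDiff_fst.comp_contDiffOn hκ.symm.contDiffOn_section
  have hRs : ContDiffOn ℝ ∞ R U' := contDiff_snd.comp_contDiffOn hκ.symm.contDiffOn_section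
  have hmaps : MapsTo ψ B U' := fun x hx => hκ.base_mem hx
  -- κ̄⁻¹ is read at ψ(x), so that P and Q become functions on the body; by its form Q is the
  -- coordinate frame of ψ.
  set P : E → End E := fun x => R (ψ x) with hP
  set Q : E → End E := fun x => fderiv ℝ ψ.symm (ψ x) with hQ
  have hPs : ContDiffOn ℝ ∞ P B := hRs.comp hψs hmaps
  have hQs : ContDiffOn ℝ ∞ Q B :=
    (hψt.fderiv_of_isOpen hκ.isOpen_right (m := ∞) (by simp)).comp hψs hmaps
  have hjet : ∀ x ∈ B, frameJet (κ.symm ∘ frameTransl (κ (x, 1)).1) 0 = prolongation P Q x := by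
    intro x hx
    have hy : ψ x ∈ U' := hmaps hx
    refine (frameJet_comp_frameTransl hκ.symm hy).trans ?_
    have hRd : HasFDerivAt R (fderiv ℝ R (ψ x)) (ψ x) :=
      ((hRs.contDiffAt (hκ.isOpen_right.mem_nhds hy)).differentiableAt (by simp)).hasFDerivAt
    have hψd : HasFDerivAt ψ (fderiv ℝ ψ x) x :=
      ((hψs.contDiffAt (hκ.isOpen_left.mem_nhds hx)).differentiableAt (by simp)).hasFDerivAt
    have hψi : HasFDerivAt ψ.symm (fderiv ℝ ψ.symm (ψ x)) (ψ x) :=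
      ((hψt.contDiffAt (hκ.isOpen_right.mem_nhds hy)).differentiableAt (by simp)).hasFDerivAt
    -- The last component requires dR = dP ∘ Q, which follows from dP = dR ∘ dψ and dψ ∘ Q = id.
    have hinv : fderiv ℝ ψ x ∘L fderiv ℝ ψ.symm (ψ x) = ContinuousLinearMap.id ℝ E := by
      have hl : ψ.symm (ψ x) = x := ψ.left_inv hx
      have hc := HasFDerivAt.comp (g := ψ) (f := ψ.symm) (ψ x) (hl.symm ▸ hψd) hψi
      have hev : id =ᶠ[𝓝 (ψ x)] ψ ∘ ψ.symm := by
        filter_upwards [hκ.isOpen_right.mem_nhds hy] with y hy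
        exact (ψ.right_inv hy).symm
      have hu := (hc.congr_of_eventuallyEq hev).unique (hasFDerivAt_id (ψ x))
      rwa [hl] at hu
    have hPd : fderiv ℝ P x = fderiv ℝ R (ψ x) ∘L fderiv ℝ ψ x := (hRd.comp x hψd).fderiv
    refine Prod.ext rfl (Prod.ext (ψ.left_inv hx) (Prod.ext rfl (Prod.ext rfl ?_)))
    change fderiv ℝ R (ψ x) = fderiv ℝ P x ∘L fderiv ℝ ψ.symm (ψ x)
    rw [hPd, ContinuousLinearMap.comp_assoc, hinv, ContinuousLinearMap.comp_id]
  have hmem : ∀ x ∈ B, prolongation P Q x ∈ uniformReferences B W Z₀ := fun x hx =>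
    hjet x hx ▸ hm x hx
  have hσ : IsUniformSection B W Z₀ (prolongation P Q) :=
    ⟨contDiffOn_const.prodMk (contDiffOn_id.prodMk (hPs.prodMk (hQs.prodMk
      ((hPs.fderiv_of_isOpen hB (m := ∞) (by simp)).clm_comp hQs)))), hmem, fun _ _ => rfl⟩
  have hu : ∀ x ∈ B, IsUnit (P x) ∧ IsUnit (Q x) := fun x hx => (hσ.isUnit hΩ hZ₀ hx).2
  exact ⟨hσ.isGStructure hB hΩ hZ₀, fun x hx => ⟨B, hB, hx, subset_rfl, P, Q,
    ⟨hPs, fun y hy => (hu y hy).1⟩, ⟨hQs, fun y hy => (hu y hy).2⟩,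
    fun y hy => ⟨ψ, hy, subset_rfl, hψs, hψt, fun _ _ => rfl⟩, hmem⟩⟩

theorem IsIntegrableProlongation.isLocallyHomogeneous {G : Set (Jet E)}
    (h : IsIntegrableProlongation B G (uniformReferences B W Z₀)) :
    IsLocallyHomogeneous B W Z₀ := by
  intro x hx
  obtain ⟨U, -, hxU, hUB, P, Q, ⟨hPs, hPu⟩, -, hQ, hm⟩ := h.2 x hx
  obtain ⟨ψ, hxψ, hψU, hψs, hψt, hQψ⟩ := hQ x hxU
  have hmaps : MapsTo ψ.symm ψ.target U := fun y hy => hψU (ψ.map_target hy)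
  have hR : ContDiffOn ℝ ∞ (P ∘ ψ.symm) ψ.symm.source := hPs.comp hψt hmaps
  -- This is κ̄⁻¹, built over the chart range; the deformation is its inverse, defined over the
  -- chart domain.
  have hI := isFrameIso_frameIso (ψ := ψ.symm) (R := P ∘ ψ.symm) hψt hψs hR
    fun y hy => hPu _ (hmaps hy)
  refine ⟨ψ.source, ψ.open_source, hxψ, hψU.trans hUB, _, _, hI.symm, fun y hy => ?_⟩
  have hv : ψ y ∈ ψ.symm.source := ψ.map_source hy
  have hl : ψ.symm (ψ y) = y := ψ.left_inv hy
  refine (Set.mem_of_eq_of_mem ?_ (hm y (hψU hy)))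
  refine (frameJet_comp_frameTransl hI hv).trans ?_
  have hPd : HasFDerivAt P (fderiv ℝ P y) (ψ.symm (ψ y)) := by
    rw [hl]
    exact ((hPs.mono hψU).contDiffAt (ψ.open_source.mem_nhds hy)).differentiableAt
      (by simp) |>.hasFDerivAt
  have hψd : HasFDerivAt ψ.symm (Q y) (ψ y) := by
    rw [hQψ y hy]
    exact ((hψt.contDiffAt (ψ.open_target.mem_nhds hv)).differentiableAt (by simp)).hasFDerivAt
  refine Prod.ext rfl (Prod.ext hl (Prod.ext ?_ (Prod.ext hψd.fderiv ?_)))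
  · change P (ψ.symm (ψ y)) * 1 = P y
    rw [hl, mul_one]
  · change fderiv ℝ (fun q => P (ψ.symm q) * 1) (ψ y) = fderiv ℝ P y ∘L Q y
    simp only [mul_one]
    exact (hPd.comp (ψ y) hψd).fderiv

end Material

end Cosserat

end

theorem mainTheorem6 {V : Type*} [NormedAddCommGroup V] [NormedSpace ℝ V]
    (B : Set (EuclideanSpace ℝ (Fin 3))) (hB : IsOpen B) (W : Jet (EuclideanSpace ℝ (Fin 3)) → V)
    (hW : IsMechanicalResponse B W)
    (hΩ : IsLieSubgroupoid B (materialGroupoid B W))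
    (Z₀ : Jet (EuclideanSpace ℝ (Fin 3))) (hZ₀ : Z₀ ∈ nonholonomicFrames B) :
    (IsHomogeneous B W Z₀ →
      IsIntegrableProlongation B (crystalGroup B W Z₀) (uniformReferences B W Z₀)) ∧
    (IsIntegrableProlongation B (crystalGroup B W Z₀) (uniformReferences B W Z₀) →
      IsLocallyHomogeneous B W Z₀) :=
  ⟨fun h => h.isIntegrableProlongation hB hΩ hZ₀, fun h => h.isLocallyHomogeneous⟩
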